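/- For a monoid $M$, let $\mathrm{Lin}(M,M)$ be the constraint satisfaction problem $\mathrm{CSP}(\mathbf A)$ of the relational structure $\mathbf A$ with universe $M$, the ternary relation $\{(s_1,s_2,s_3)\in M^3 : s_1s_2=s_3\}$, and the unary relation $\{t\}$ for every $t\in M$. Recall that a map $p:M^{2k+1}\to M$, $k\ge 1$, is alternating if it is invariant under all parity-preserving permutations of its coordinates and $p(a,a,x_3,\dots,x_{2k+1})=p(b,b,x_3,\dots,x_{2k+1})$ for all $a,b,x_3,\dots,x_{2k+1}\in M$. Let $G$ be an arbitrary finite Abelian group, and let $M$ be the monoid resulting from adding to $G$ a fresh element $e$ that serves as the monoid identity. Then $\mathrm{Lin}(M,M)$ is solved by the $\mathrm{BLP}+\mathrm{AIP}$ algorithm (basic linear programming combined with affine integer programming) but not by the $\mathrm{AIP}$ algorithm. Moreover, $\mathrm{Lin}(M,M)$ has no alternating polymorphism of arity $2k+1$ for any $k\ge 1$. Here an algorithm solves $\mathrm{CSP}(\mathbf A)$ if it accepts exactly those finite instances $\mathbf X$ that admit a homomorphism to $\mathbf A$. The relaxation of $\mathbf X$ has a variable $\lambda_x(a)$ for each $x\in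 X$, $a\in A$, and a variable $\lambda_{R,\mathbf x}(\mathbf a)$ for each relation symbol $R$, $\mathbf x\in R^{\mathbf X}$, $\mathbf a\in R^{\mathbf A}$, with the equations $\sum_a\lambda_x(a)=1$, $\sum_{\mathbf a}\lambda_{R,\mathbf x}(\mathbf a)=1$ and $\sum_{\mathbf a:\,a_i=a}\lambda_{R,\mathbf x}(\mathbf a)=\lambda_{x_i}(a)$. $\mathrm{AIP}$ accepts if these equations have an integer solution. $\mathrm{BLP}+\mathrm{AIP}$ takes a point in the relative interior of the polytope of nonnegative real solutions (rejecting if there is none), and accepts if the equations have an integer solution that is zero at every variable at which this point is zero. -/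

import Mathlib

open FirstOrder

namespace PromiseEq

universe u v w

section Algorithms

/- Relational signatures and structures are Mathlib's first-order languages and structures;
`X →[L] A` is the type of maps preserving all relations. A template `(A, B)` is given by two finite
`L`-structures. The signatures used here have no function symbols and finitely many relations. -/
variable (L : FirstOrder.Language.{v, w})

/-- The variables of the basic LP / affine IP relaxation of the instance `X` over the template
structure `A`: one variable for each `x ∈ X` and `a ∈ A`, and one variable for each relation
symbol `R`, each tuple `x ∈ R^X` and each tuple `a ∈ R^A`. -/
abbrev RelaxVar (X : Type) (A : Type u) [L.Structure X] [L.Structure A] : Type (max u w) :=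
  (X × A) ⊕
    (Σ (n : ℕ) (R : L.Relations n),
      {x : Fin n → X // FirstOrder.Language.Structure.RelMap R x} ×
      {a : Fin n → A // FirstOrder.Language.Structure.RelMap R a})

variable {L}

/-- The system of linear equations of the relaxation, over a coefficient ring `𝕜`
(`𝕜 = ℝ` for BLP and `𝕜 = ℤ` for AIP): the weights of each element of `X` sum to one, the weights
of each constraint sum to one, and the marginals of the constraint weights are the weights of
the elements. -/
structure IsRelaxSolution {𝕜 : Type} [CommRing 𝕜] {X : Type} {A : Type u} [Finite X] [Finite A]
    [L.Structure X] [L.Structure A] (f : RelaxVar L X A → 𝕜) : Prop where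
  sum_elem : ∀ x : X, ∑ᶠ a : A, f (Sum.inl (x, a)) = 1
  sum_constraint : ∀ (n : ℕ) (R : L.Relations n)
    (x : {x : Fin n → X // FirstOrder.Language.Structure.RelMap R x}),
    ∑ᶠ t : {a : Fin n → A // FirstOrder.Language.Structure.RelMap R a}, f (Sum.inr ⟨n, R, x, t⟩) = 1
  marginal : ∀ (n : ℕ) (R : L.Relations n)
    (x : {x : Fin n → X // FirstOrder.Language.Structure.RelMap R x}) (i : Fin n) (a : A),
    ∑ᶠ (t : {a : Fin n → A // FirstOrder.Language.Structure.RelMap R a}) (_ : t.1 i = a),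
      f (Sum.inr ⟨n, R, x, t⟩) = f (Sum.inl (x.1 i, a))

variable (L)

/-- The polytope of the basic linear programming relaxation of `X` over `A`. -/
def blpPolytope (X : Type) (A : Type u) [Finite X] [Finite A] [L.Structure X] [L.Structure A] :
    Set (RelaxVar L X A → ℝ) :=
  {f | IsRelaxSolution f ∧ ∀ c, 0 ≤ f c}

/-- AIP accepts `X` if the relaxation has an integer solution. -/
def AIPAccepts (X : Type) (A : Type u) [Finite X] [Finite A] [L.Structure X] [L.Structure A] :
    Prop :=
  ∃ g : RelaxVar L X A → ℤ, IsRelaxSolution g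

/-- BLP+AIP takes a point in the relative interior of the BLP polytope (rejecting if there is
none), sets to zero all variables of the AIP relaxation that are zero at that point, and accepts if
the system so refined has an integer solution. The outcome does not depend on the
chosen point, since all points in the relative interior have the same support. -/
def BLPAIPAccepts (X : Type) (A : Type u) [Finite X] [Finite A] [L.Structure X] [L.Structure A] :
    Prop :=
  ∃ f ∈ intrinsicInterior ℝ (blpPolytope L X A),
    ∃ g : RelaxVar L X A → ℤ, IsRelaxSolution g ∧ ∀ c, f c = 0 → g c = 0

/-- `PCSP(A, B)` is solved by AIP: every instance with `X → A` is accepted, and every instance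
with `X ↛ B` is rejected. -/
def SolvedByAIP (A B : Type u) [Finite A] [Finite B] [L.Structure A] [L.Structure B] : Prop :=
  ∀ (X : Type) [Finite X] [L.Structure X],
    (Nonempty (X →[L] A) → AIPAccepts L X A) ∧ (¬ Nonempty (X →[L] B) → ¬ AIPAccepts L X A)

/-- `PCSP(A, B)` is solved by BLP+AIP. -/
def SolvedByBLPAIP (A B : Type u) [Finite A] [Finite B] [L.Structure A] [L.Structure B] : Prop :=
  ∀ (X : Type) [Finite X] [L.Structure X],
    (Nonempty (X →[L] A) → BLPAIPAccepts L X A) ∧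
      (¬ Nonempty (X →[L] B) → ¬ BLPAIPAccepts L X A)

/-- `k`-ary polymorphisms of `(A, B)`. The matrix is given by its columns `M j`. -/
def IsPolymorphism {A B : Type u} [L.Structure A] [L.Structure B] {k : ℕ}
    (p : (Fin k → A) → B) : Prop :=
  ∀ (n : ℕ) (R : L.Relations n) (M : Fin k → Fin n → A),
    (∀ j, FirstOrder.Language.Structure.RelMap R (M j)) →
      FirstOrder.Language.Structure.RelMap R (fun i => p (fun j => M j i))

end Algorithms

/-- The minor of `p` given by `π`. -/
def minor {A B : Type u} {n m : ℕ} (p : (Fin n → A) → B) (π : Fin n → Fin m) :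
    (Fin m → A) → B :=
  fun a => p (fun i => a (π i))

/-- Alternating maps of arity `2k+1`, `k ≥ 1` (coordinates are numbered from `0`):
invariant under parity preserving permutations of the coordinates, and the two minors that
identify the first two coordinates, by sending both to the first, respectively both to the second
coordinate, are equal. -/
def IsAlternating {A B : Type u} {k : ℕ} (p : (Fin (2 * k + 1) → A) → B) : Prop :=
  (∀ π : Equiv.Perm (Fin (2 * k + 1)), (∀ i, (π i).val % 2 = i.val % 2) → minor p π = p) ∧
    minor p (fun j => if j.val ≤ 1 then (0 : Fin (2 * k + 1)) else j) =
      minor p (fun j => if j.val ≤ 1 then (1 : Fin (2 * k + 1)) else j)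

/-- The relation symbols of `Lin(S, T)`: a ternary one, and a unary one for each `t ∈ T`. -/
inductive LinRel (T : Type u) : ℕ → Type u
  | mul : LinRel T 3
  | const (t : T) : LinRel T 1

/-- The signature of `Lin(S, T)`. -/
def linLang (T : Type u) : FirstOrder.Language.{0, u} where
  Functions := fun _ => Empty
  Relations := LinRel T

/-- The relational structure `Lin(S, T)` for a subsemigroup `T` of a semigroup `S`. -/
instance linStructure {S : Type u} [Semigroup S] (T : Subsemigroup S) :
    (linLang T).Structure S where
  funMap := fun f => nomatch f
  RelMap := fun {_} R =>
    match R with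
    | LinRel.mul => fun s => s 0 * s 1 = s 2
    | LinRel.const t => fun s => s 0 = t

/-- `WithOne G`, i.e. `G` with a fresh identity adjoined, is finite if `G` is. -/
instance finiteWithOne {G : Type u} [Finite G] : Finite (WithOne G) :=
  inferInstanceAs (Finite (Option G))

end PromiseEq

open FirstOrder

/-! In `WithOne G` a product is the adjoined identity `1` only if both factors are, and collapsing
`1` onto the identity of `G` is a homomorphism onto an Abelian group. A BLP point decides which
variables must take the value `1`, and an integer solution supported inside it solves the remaining
equations over `G` (`nonempty_hom_of_blpAIPAccepts`). Conversely, a homomorphism is a 0/1 solution,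
and relative interior points have maximal support (`blpAIPAccepts_of_hom`).

AIP alone allows cancellation, so it cannot see that `1` does not factor through `G`: it accepts `x
* y = z`, `y = u`, `z = 1`, where `u` is the identity of `G` (`not_solvedByAIP`).

A polymorphism is an idempotent monoid homomorphism from a power of `WithOne G`. If it were
alternating, it would send every tuple with one entry `u` and all others `1` to `1`, hence also
their product, the constant tuple `u`. -/

namespace PromiseEq

universe u v w

/-! ### Solutions of the relaxation and supports of BLP points -/

section Relaxation

variable {L : FirstOrder.Language.{v, w}}

/-- The point of the relaxation given by a homomorphism. -/
noncomputable def homPoint (𝕜 : Type) [CommRing 𝕜] {X : Type} {A : Type u} [L.Structure X]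
    [L.Structure A] (h : X → A) : RelaxVar L X A → 𝕜 := by
  classical
  exact Sum.elim (fun c => if c.2 = h c.1 then 1 else 0)
    (fun c => if c.2.2.2.1 = h ∘ c.2.2.1.1 then 1 else 0)

section HomPoint

variable {𝕜 : Type} [CommRing 𝕜] {X : Type} {A : Type u} [L.Structure X] [L.Structure A]

lemma finsum_homPoint_elem (h : X → A) (x : X) :
    ∑ᶠ a : A, homPoint (L := L) 𝕜 h (Sum.inl (x, a)) = 1 := by
  rw [finsum_eq_single _ (h x)]
  · simp [homPoint]
  · intro a ha
    simp [homPoint, ha]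

lemma finsum_homPoint_constraint {h : X → A} {n : ℕ} {R : L.Relations n}
    {x : {x : Fin n → X // FirstOrder.Language.Structure.RelMap R x}}
    (hx : FirstOrder.Language.Structure.RelMap R (h ∘ x.1)) :
    ∑ᶠ t : {a : Fin n → A // FirstOrder.Language.Structure.RelMap R a},
      homPoint 𝕜 h (Sum.inr ⟨n, R, x, t⟩) = 1 := by
  rw [finsum_eq_single _ ⟨h ∘ x.1, hx⟩]
  · simp [homPoint]
  · intro t ht
    have : t.1 ≠ h ∘ x.1 := fun e => ht (Subtype.ext e)
    simp [homPoint, this]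

lemma finsum_homPoint_marginal {h : X → A} {n : ℕ} {R : L.Relations n}
    {x : {x : Fin n → X // FirstOrder.Language.Structure.RelMap R x}}
    (hx : FirstOrder.Language.Structure.RelMap R (h ∘ x.1)) (i : Fin n) (a : A) :
    ∑ᶠ (t : {a : Fin n → A // FirstOrder.Language.Structure.RelMap R a}) (_ : t.1 i = a),
      homPoint 𝕜 h (Sum.inr ⟨n, R, x, t⟩) = homPoint (L := L) 𝕜 h (Sum.inl (x.1 i, a)) := by
  classical
  rw [finsum_eq_single _ ⟨h ∘ x.1, hx⟩]
  · simp [homPoint, finsum_eq_if, eq_comm]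
  · intro t ht
    have : t.1 ≠ h ∘ x.1 := fun e => ht (Subtype.ext e)
    simp [homPoint, this]

lemma isRelaxSolution_homPoint [Finite X] [Finite A] (h : X →[L] A) :
    IsRelaxSolution (homPoint (L := L) 𝕜 (h : X → A)) where
  sum_elem := finsum_homPoint_elem _
  sum_constraint _ R x := finsum_homPoint_constraint (h.map_rel R x.1 x.2)
  marginal _ R x := finsum_homPoint_marginal (h.map_rel R x.1 x.2)

/-- A signed combination `h₀ - h₁ + h₂` of maps is a solution if for each constraint either all three
maps satisfy it, or two of them cancel and the third one satisfies it. -/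
lemma isRelaxSolution_sub_add [Finite X] [Finite A] {h₀ h₁ h₂ : X → A}
    (H : ∀ (n : ℕ) (R : L.Relations n) (x : Fin n → X),
      FirstOrder.Language.Structure.RelMap R x →
      (FirstOrder.Language.Structure.RelMap R (h₀ ∘ x) ∧
        FirstOrder.Language.Structure.RelMap R (h₁ ∘ x) ∧
        FirstOrder.Language.Structure.RelMap R (h₂ ∘ x)) ∨
      (h₀ ∘ x = h₁ ∘ x ∧ FirstOrder.Language.Structure.RelMap R (h₂ ∘ x)) ∨
      (h₁ ∘ x = h₂ ∘ x ∧ FirstOrder.Language.Structure.RelMap R (h₀ ∘ x))) :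
    IsRelaxSolution (L := L)
      (fun c => homPoint 𝕜 h₀ c - homPoint 𝕜 h₁ c + homPoint 𝕜 h₂ c) where
  sum_elem x := by
    rw [finsum_add_distrib (Set.toFinite _) (Set.toFinite _),
      finsum_sub_distrib (Set.toFinite _) (Set.toFinite _)]
    simp [finsum_homPoint_elem]
  sum_constraint n R x := by
    obtain ⟨H0, H1, H2⟩ | ⟨h, H2⟩ | ⟨h, H0⟩ := H n R x.1 x.2
    · rw [finsum_add_distrib (Set.toFinite _) (Set.toFinite _),
        finsum_sub_distrib (Set.toFinite _) (Set.toFinite _)]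
      simp [finsum_homPoint_constraint H0, finsum_homPoint_constraint H1,
        finsum_homPoint_constraint H2]
    · rw [← finsum_homPoint_constraint (𝕜 := 𝕜) H2]
      exact finsum_congr fun t => by simp only [homPoint, Sum.elim_inr]; rw [h]; simp
    · rw [← finsum_homPoint_constraint (𝕜 := 𝕜) H0]
      exact finsum_congr fun t => by simp only [homPoint, Sum.elim_inr]; rw [h]; simp
  marginal n R x i a := by
    obtain ⟨H0, H1, H2⟩ | ⟨h, H2⟩ | ⟨h, H0⟩ := H n R x.1 x.2
    · rw [← finsum_homPoint_marginal H0, ← finsum_homPoint_marginal H1,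
        ← finsum_homPoint_marginal H2,
        ← finsum_sub_distrib (Set.toFinite _) (Set.toFinite _),
        ← finsum_add_distrib (Set.toFinite _) (Set.toFinite _)]
      exact finsum_congr fun t => by by_cases h : t.1 i = a <;> simp [h]
    · have hi : h₀ (x.1 i) = h₁ (x.1 i) := congrFun h i
      trans homPoint (L := L) 𝕜 h₂ (Sum.inl (x.1 i, a))
      · rw [← finsum_homPoint_marginal H2]
        exact finsum_congr fun t => finsum_congr fun _ => by simp only [homPoint, Sum.elim_inr]; rw [h]; simp
      · simp only [homPoint, Sum.elim_inl]; rw [hi]; simp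
    · have hi : h₁ (x.1 i) = h₂ (x.1 i) := congrFun h i
      trans homPoint (L := L) 𝕜 h₀ (Sum.inl (x.1 i, a))
      · rw [← finsum_homPoint_marginal H0]
        exact finsum_congr fun t => finsum_congr fun _ => by simp only [homPoint, Sum.elim_inr]; rw [h]; simp
      · simp only [homPoint, Sum.elim_inl]; rw [hi]; simp

end HomPoint

lemma homPoint_nonneg {X : Type} {A : Type u} [L.Structure X] [L.Structure A] (h : X → A)
    (c : RelaxVar L X A) : 0 ≤ homPoint ℝ h c := by
  rcases c with c | c <;> simp only [homPoint, Sum.elim_inl, Sum.elim_inr] <;> split_ifs <;> simp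

lemma homPoint_intCast {X : Type} {A : Type u} [L.Structure X] [L.Structure A] (h : X → A)
    (c : RelaxVar L X A) : ((homPoint ℤ h c : ℤ) : ℝ) = homPoint ℝ h c := by
  rcases c with c | c <;> simp [homPoint]

lemma convex_blpPolytope (X : Type) (A : Type u) [Finite X] [Finite A] [L.Structure X]
    [L.Structure A] : Convex ℝ (blpPolytope L X A) := by
  rintro f ⟨hf, hf0⟩ g ⟨hg, hg0⟩ a b ha hb hab
  refine ⟨⟨fun x => ?_, fun n R x => ?_, fun n R x i c => ?_⟩, fun c => ?_⟩
  · simp only [Pi.add_apply, Pi.smul_apply]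
    rw [finsum_add_distrib (Set.toFinite _) (Set.toFinite _), ← smul_finsum, ← smul_finsum,
      hf.sum_elem, hg.sum_elem]
    simpa using hab
  · simp only [Pi.add_apply, Pi.smul_apply]
    rw [finsum_add_distrib (Set.toFinite _) (Set.toFinite _), ← smul_finsum, ← smul_finsum,
      hf.sum_constraint, hg.sum_constraint]
    simpa using hab
  · simp only [Pi.add_apply, Pi.smul_apply]
    rw [← hf.marginal, ← hg.marginal, smul_finsum, smul_finsum,
      ← finsum_add_distrib (Set.toFinite _) (Set.toFinite _)]
    refine finsum_congr fun t => ?_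
    by_cases h : t.1 i = c <;> simp [h]
  · exact add_nonneg (mul_nonneg ha (hf0 c)) (mul_nonneg hb (hg0 c))

/-- The line through `q` and `f` stays in the affine span, where `f` is an interior point, so the
segment from `q` can be prolonged slightly beyond `f`. -/
lemma exists_add_smul_mem_of_mem_intrinsicInterior {ι : Type*} {s : Set (ι → ℝ)} {f q : ι → ℝ}
    (hf : f ∈ intrinsicInterior ℝ s) (hq : q ∈ s) :
    ∃ ε > (0 : ℝ), AffineMap.lineMap q f (1 + ε) ∈ s := by
  obtain ⟨y, hy, rfl⟩ := mem_intrinsicInterior.1 hf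
  let l : ℝ → affineSpan ℝ s := fun r =>
    ⟨AffineMap.lineMap q (y : ι → ℝ) r,
      AffineMap.lineMap_mem r (subset_affineSpan ℝ s hq) y.2⟩
  have hl : Continuous l := by
    refine Continuous.subtype_mk ?_ _
    exact AffineMap.lineMap_continuous
  have h1 : l 1 = y := Subtype.ext (by simp [l])
  have hmem : l ⁻¹' interior ((↑) ⁻¹' s) ∈ nhds (1 : ℝ) :=
    (isOpen_interior.preimage hl).mem_nhds (by simpa [h1] using hy)
  obtain ⟨ε, hε, hb⟩ := Metric.mem_nhds_iff.1 hmem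
  refine ⟨ε / 2, by positivity, ?_⟩
  have : l (1 + ε / 2) ∈ interior ((↑) ⁻¹' s) := hb (by
    rw [Metric.mem_ball, Real.dist_eq, add_sub_cancel_left, abs_of_pos (by positivity)]
    linarith)
  exact (interior_subset this : l (1 + ε / 2) ∈ ((↑) ⁻¹' s : Set (affineSpan ℝ s)))

/-- Points in the relative interior of the polytope have maximal support. -/
lemma eq_zero_of_mem_intrinsicInterior {X : Type} {A : Type u} [Finite X] [Finite A]
    [L.Structure X] [L.Structure A] {f q : RelaxVar L X A → ℝ}
    (hf : f ∈ intrinsicInterior ℝ (blpPolytope L X A)) (hq : q ∈ blpPolytope L X A)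
    {c : RelaxVar L X A} (hc : f c = 0) : q c = 0 := by
  obtain ⟨ε, hε, h⟩ := exists_add_smul_mem_of_mem_intrinsicInterior hf hq
  have h1 := h.2 c
  have h2 := hq.2 c
  simp only [AffineMap.lineMap_apply, vsub_eq_sub, vadd_eq_add, Pi.add_apply, Pi.smul_apply,
    Pi.sub_apply, hc, smul_eq_mul] at h1
  -- The prolonged point has coordinate `-ε * q c` at `c`, which must be nonnegative.
  nlinarith [mul_nonneg hε.le h2]

lemma blpAIPAccepts_of_hom {X : Type} {A : Type u} [Finite X] [Finite A]
    [L.Structure X] [L.Structure A] [Finite (RelaxVar L X A)] (h : X →[L] A) :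
    BLPAIPAccepts L X A := by
  have := Fintype.ofFinite (RelaxVar L X A)
  have hmem : homPoint ℝ (h : X → A) ∈ blpPolytope L X A :=
    ⟨isRelaxSolution_homPoint h, homPoint_nonneg _⟩
  obtain ⟨f, hf⟩ := Set.Nonempty.intrinsicInterior (convex_blpPolytope X A) ⟨_, hmem⟩
  refine ⟨f, hf, homPoint ℤ (h : X → A), isRelaxSolution_homPoint h, fun c hc => ?_⟩
  have := eq_zero_of_mem_intrinsicInterior hf hmem hc
  rw [← homPoint_intCast] at this
  exact_mod_cast this

lemma IsRelaxSolution.exists_tuple {𝕜 : Type} [CommRing 𝕜] {X : Type} {A : Type u} [Finite X]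
    [Finite A] [L.Structure X] [L.Structure A] {f : RelaxVar L X A → 𝕜} (hf : IsRelaxSolution f)
    {n : ℕ} (R : L.Relations n)
    (x : {x : Fin n → X // FirstOrder.Language.Structure.RelMap R x}) (i : Fin n) {a : A}
    (ha : f (Sum.inl (x.1 i, a)) ≠ 0) :
    ∃ t : {a : Fin n → A // FirstOrder.Language.Structure.RelMap R a},
      t.1 i = a ∧ f (Sum.inr ⟨n, R, x, t⟩) ≠ 0 := by
  rw [← hf.marginal n R x i a] at ha
  by_contra! h
  refine ha (finsum_eq_zero_of_forall_eq_zero fun t => ?_)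
  by_cases hi : t.1 i = a <;> simp [hi, h t]

/-- Nonnegativity rules out cancellation: a positive tuple weight makes each of its marginals
positive. -/
lemma ne_zero_of_mem_blpPolytope {X : Type} {A : Type u} [Finite X] [Finite A]
    [L.Structure X] [L.Structure A] {f : RelaxVar L X A → ℝ} (hf : f ∈ blpPolytope L X A)
    {n : ℕ} {R : L.Relations n}
    {x : {x : Fin n → X // FirstOrder.Language.Structure.RelMap R x}}
    {t : {a : Fin n → A // FirstOrder.Language.Structure.RelMap R a}}
    (ht : f (Sum.inr ⟨n, R, x, t⟩) ≠ 0) (i : Fin n) : f (Sum.inl (x.1 i, t.1 i)) ≠ 0 := by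
  classical
  rw [← hf.1.marginal n R x i]
  simp only [finsum_eq_if]
  refine ((lt_of_le_of_ne (hf.2 _) ht.symm).trans_le ?_).ne'
  have := single_le_finsum (f := fun s : {a : Fin n → A //
      FirstOrder.Language.Structure.RelMap R a} =>
    if s.1 i = t.1 i then f (Sum.inr ⟨n, R, x, s⟩) else 0) t (Set.toFinite _)
    (fun s => by split_ifs; exacts [hf.2 _, le_rfl])
  simpa using this

/-- The marginal equations in multiplicative form. -/
lemma IsRelaxSolution.prod_zpow {X : Type} {A : Type u} {H : Type*} [CommGroup H] [Finite X]
    [Fintype A] [L.Structure X] [L.Structure A] {g : RelaxVar L X A → ℤ} (hg : IsRelaxSolution g)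
    {n : ℕ} (R : L.Relations n)
    [Fintype {a : Fin n → A // FirstOrder.Language.Structure.RelMap R a}]
    (x : {x : Fin n → X // FirstOrder.Language.Structure.RelMap R x}) (i : Fin n) (φ : A → H) :
    ∏ a, φ a ^ g (Sum.inl (x.1 i, a)) =
      ∏ t : {a : Fin n → A // FirstOrder.Language.Structure.RelMap R a},
        φ (t.1 i) ^ g (Sum.inr ⟨n, R, x, t⟩) := by
  classical
  have key (a : A) : φ a ^ g (Sum.inl (x.1 i, a)) =
      ∏ t : {a : Fin n → A // FirstOrder.Language.Structure.RelMap R a},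
        if t.1 i = a then φ (t.1 i) ^ g (Sum.inr ⟨n, R, x, t⟩) else 1 := by
    rw [← hg.marginal n R x i a, finsum_eq_sum_of_fintype]
    simp only [finsum_eq_if]
    rw [show ∀ F : _ → ℤ, φ a ^ ∑ t, F t = ∏ t, φ a ^ F t from
      fun F => map_prod (zpowersHom H (φ a)) (fun t => Multiplicative.ofAdd (F t)) _]
    refine Finset.prod_congr rfl fun t _ => ?_
    split_ifs with h
    · rw [h]
    · simp
  simp only [key]
  rw [Finset.prod_comm]
  simp

end Relaxation

/-! ### Linear equations over a group with an adjoined identity -/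

section Lin

/-- Finite dimension ensures that a nonempty BLP polytope has a relative interior point. -/
instance finite_relaxVar_lin {S : Type u} [Semigroup S] (T : Subsemigroup S) [Finite S]
    (X : Type) [Finite X] [(linLang T).Structure X] : Finite (RelaxVar (linLang T) X S) := by
  have : Finite (Σ n, (linLang T).Relations n) := by
    refine Finite.of_surjective
      (fun o : Option T => (o.elim ⟨3, LinRel.mul⟩ fun t => ⟨1, LinRel.const t⟩ :
        Σ n, (linLang T).Relations n)) ?_
    rintro ⟨n, R⟩
    cases R with
    | mul => exact ⟨none, rfl⟩
    | const t => exact ⟨some t, rfl⟩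
  have := Finite.of_equiv _ (Equiv.sigmaAssoc fun (n : ℕ) (R : (linLang T).Relations n) =>
      {x : Fin n → X // FirstOrder.Language.Structure.RelMap R x} ×
      {a : Fin n → S // FirstOrder.Language.Structure.RelMap R a})
  exact inferInstanceAs (Finite (_ ⊕ _))

lemma WithOne.eq_one_of_mul_eq_one {G : Type*} [Mul G] {a b : WithOne G} (h : a * b = 1) :
    a = 1 ∧ b = 1 := by
  by_cases ha : a = 1
  · exact ⟨ha, by simpa [ha] using h⟩
  by_cases hb : b = 1
  · exact ⟨by simpa [hb] using h, hb⟩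
  obtain ⟨a, rfl⟩ := WithOne.ne_one_iff_exists.1 ha
  obtain ⟨b, rfl⟩ := WithOne.ne_one_iff_exists.1 hb
  exact absurd h (by rw [← WithOne.coe_mul]; exact WithOne.coe_ne_one)

variable {G : Type u} [CommGroup G]

/-- Only membership of `f` in the polytope is used, not that it is an interior point. -/
lemma nonempty_hom_of_blpAIPAccepts [Finite G] {X : Type} [Finite X]
    [(linLang (⊤ : Subsemigroup (WithOne G))).Structure X]
    (h : BLPAIPAccepts (linLang (⊤ : Subsemigroup (WithOne G))) X (WithOne G)) :
    Nonempty (X →[linLang (⊤ : Subsemigroup (WithOne G))] WithOne G) := by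
  classical
  obtain ⟨f, hf, g, hg, hfg⟩ := h
  replace hf := intrinsicInterior_subset hf
  have := Fintype.ofFinite (WithOne G)
  -- `φ` is the retraction that identifies `1` with the identity of `G`, `E` marks the variables
  -- that `f` forces to be `1`, and `h₀` reads off a `G`-valued solution from the integer weights.
  let φ : WithOne G →* G := WithOne.lift (MulHom.id G)
  let E : X → Prop := fun x => ∀ a, f (Sum.inl (x, a)) ≠ 0 → a = 1
  let h₀ : X → G := fun x => ∏ a, φ a ^ g (Sum.inl (x, a))
  -- Where `f` allows only one value, `g` has weight one there and zero elsewhere.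
  have single (x : X) (a : WithOne G) (ha : ∀ b, f (Sum.inl (x, b)) ≠ 0 → b = a) :
      h₀ x = φ a ∧ f (Sum.inl (x, a)) ≠ 0 := by
    have hb (b : WithOne G) (hb : b ≠ a) : f (Sum.inl (x, b)) = 0 := by
      by_contra hne
      exact hb (ha b hne)
    have h1 := hg.sum_elem x
    rw [finsum_eq_single _ a fun b h => hfg _ (hb b h)] at h1
    refine ⟨?_, fun h0 => by simp [hfg _ h0] at h1⟩
    change ∏ b, φ b ^ g (Sum.inl (x, b)) = φ a
    rw [Finset.prod_eq_single a (fun b _ h => by rw [hfg _ (hb b h), zpow_zero]) (by simp), h1,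
      zpow_one]
  refine ⟨⟨fun x => if E x then 1 else (h₀ x : WithOne G), (fun f => nomatch f), ?_⟩⟩
  intro n R x hx
  cases R with
  | mul =>
    change (if E (x 0) then 1 else (h₀ (x 0) : WithOne G)) *
      (if E (x 1) then 1 else (h₀ (x 1) : WithOne G)) = if E (x 2) then 1 else (h₀ (x 2) : WithOne G)
    let R : (linLang (⊤ : Subsemigroup (WithOne G))).Relations 3 := LinRel.mul
    let y : {x : Fin 3 → X // FirstOrder.Language.Structure.RelMap R x} := ⟨x, hx⟩
    have ht (t : {a : Fin 3 → WithOne G // FirstOrder.Language.Structure.RelMap R a}) :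
      t.1 0 * t.1 1 = t.1 2 := t.2
    have hmul : h₀ (x 2) = h₀ (x 0) * h₀ (x 1) := by
      have := Fintype.ofFinite
        {a : Fin 3 → WithOne G // FirstOrder.Language.Structure.RelMap R a}
      change ∏ a, φ a ^ g (Sum.inl (y.1 2, a)) =
        (∏ a, φ a ^ g (Sum.inl (y.1 0, a))) * ∏ a, φ a ^ g (Sum.inl (y.1 1, a))
      rw [hg.prod_zpow R y, hg.prod_zpow R y, hg.prod_zpow R y, ← Finset.prod_mul_distrib]
      exact Finset.prod_congr rfl fun t _ => by rw [← mul_zpow, ← map_mul, ht]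
    have hE : E (x 2) ↔ E (x 0) ∧ E (x 1) := by
      constructor
      · refine fun h => ⟨fun a ha => ?_, fun a ha => ?_⟩
        · obtain ⟨t, rfl, h0⟩ := hf.1.exists_tuple R y 0 ha
          have := h _ (ne_zero_of_mem_blpPolytope hf h0 2)
          exact (WithOne.eq_one_of_mul_eq_one ((ht t).trans this)).1
        · obtain ⟨t, rfl, h0⟩ := hf.1.exists_tuple R y 1 ha
          have := h _ (ne_zero_of_mem_blpPolytope hf h0 2)
          exact (WithOne.eq_one_of_mul_eq_one ((ht t).trans this)).2
      · intro h a ha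
        obtain ⟨t, rfl, h0⟩ := hf.1.exists_tuple R y 2 ha
        rw [← ht, h.1 _ (ne_zero_of_mem_blpPolytope hf h0 0),
          h.2 _ (ne_zero_of_mem_blpPolytope hf h0 1), one_mul]
    -- Since `h₀` is trivial on `E`, multiplicativity of `h₀` also covers a product with exactly one
    -- factor in `E`.
    have hone (z : X) (hz : E z) : h₀ z = 1 := (single z 1 hz).1.trans (map_one φ)
    by_cases h0 : E (x 0) <;> by_cases h1 : E (x 1) <;> simp [hE, h0, h1, hmul, hone]
  | const t =>
    change (if E (x 0) then 1 else (h₀ (x 0) : WithOne G)) = t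
    let R : (linLang (⊤ : Subsemigroup (WithOne G))).Relations 1 := LinRel.const t
    let y : {x : Fin 1 → X // FirstOrder.Language.Structure.RelMap R x} := ⟨x, hx⟩
    have hs (b : WithOne G) (hb : f (Sum.inl (x 0, b)) ≠ 0) : b = t := by
      obtain ⟨s, rfl, -⟩ := hf.1.exists_tuple R y 0 hb
      exact s.2
    obtain ⟨h1, h2⟩ := single _ _ hs
    split_ifs with h
    · exact (h _ h2).symm
    · rw [h1]
      have hne : (t : WithOne G) ≠ 1 := fun h' => h fun a ha => (hs a ha).trans h'
      obtain ⟨a, ha⟩ := WithOne.ne_one_iff_exists.1 hne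
      rw [← ha]
      simp [φ]

/-- The instance `x * y = z`, `y = s`, `z = 1` with variables `x, y, z`. -/
abbrev mulConstInstance {S : Type u} [Monoid S] (s : S) :
    (linLang (⊤ : Subsemigroup S)).Structure (Fin 3) where
  funMap := fun f => nomatch f
  RelMap := fun {_} R =>
    match R with
    | LinRel.mul => fun x => x = id
    | LinRel.const t => fun x => (x 0 = 1 ∧ t.1 = s) ∨ (x 0 = 2 ∧ t.1 = 1)

lemma not_solvedByAIP [Finite G] :
    ¬ SolvedByAIP (linLang (⊤ : Subsemigroup (WithOne G))) (WithOne G) (WithOne G) := by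
  classical
  intro h
  let := mulConstInstance ((1 : G) : WithOne G)
  refine (h (Fin 3)).2 ?_ ?_
  · rintro ⟨p⟩
    have h0 : p 0 * p 1 = p 2 := p.map_rel
      (LinRel.mul : (linLang (⊤ : Subsemigroup (WithOne G))).Relations 3) id rfl
    have h1 : p 1 = ((1 : G) : WithOne G) := p.map_rel
      (LinRel.const ⟨((1 : G) : WithOne G), trivial⟩ : (linLang (⊤ : Subsemigroup (WithOne G))).Relations 1)
      (fun _ => 1) (Or.inl ⟨rfl, rfl⟩)
    have h2 : p 2 = 1 := p.map_rel
      (LinRel.const ⟨1, trivial⟩ : (linLang (⊤ : Subsemigroup (WithOne G))).Relations 1)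
      (fun _ => 2) (Or.inr ⟨rfl, rfl⟩)
    exact WithOne.coe_ne_one (h1.symm.trans (WithOne.eq_one_of_mul_eq_one (h0.trans h2)).2)
  · let u : WithOne G := ((1 : G) : WithOne G)
    have hu : u * u = u := by rw [← WithOne.coe_mul, one_mul]
    -- All three assignments satisfy the product; the first two agree at `y`, leaving `u`, and the
    -- last two agree at `z`, leaving `1`.
    refine ⟨_, isRelaxSolution_sub_add (h₀ := ![1, 1, 1]) (h₁ := ![u, 1, u]) (h₂ := ![u, u, u]) ?_⟩
    intro n R x hx
    cases R with
    | mul =>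
      obtain rfl : x = id := hx
      exact Or.inl ⟨one_mul 1, mul_one u, hu⟩
    | const t =>
      right
      obtain ⟨hx, ht⟩ | ⟨hx, ht⟩ : (x 0 = 1 ∧ t.1 = u) ∨ (x 0 = 2 ∧ t.1 = 1) := hx
      · refine Or.inl ⟨funext fun i => ?_, ?_⟩
        · rw [Subsingleton.elim i 0]; simp [hx]
        · change (![u, u, u] : Fin 3 → WithOne G) (x 0) = t
          rw [hx, ht]; rfl
      · refine Or.inr ⟨funext fun i => ?_, ?_⟩
        · rw [Subsingleton.elim i 0]; simp [hx]
        · change (![1, 1, 1] : Fin 3 → WithOne G) (x 0) = t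
          rw [hx, ht]; rfl

lemma not_isAlternating_of_isPolymorphism {k : ℕ} (hk : 1 ≤ k)
    {p : (Fin (2 * k + 1) → WithOne G) → WithOne G}
    (hp : IsPolymorphism (linLang (⊤ : Subsemigroup (WithOne G))) p) : ¬ IsAlternating p := by
  rintro ⟨hsymm, halt⟩
  have hconst (t : WithOne G) : p (fun _ => t) = t :=
    hp 1 (LinRel.const ⟨t, trivial⟩) (fun _ _ => t) fun _ => rfl
  have hmul (a b : Fin (2 * k + 1) → WithOne G) : p (a * b) = p a * p b :=
    (hp 3 LinRel.mul (fun j => ![a j, b j, a j * b j]) fun _ => rfl).symm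
  let P : (Fin (2 * k + 1) → WithOne G) →* WithOne G := ⟨⟨p, hconst 1⟩, hmul⟩
  let u : WithOne G := ((1 : G) : WithOne G)
  have h1v : ((1 : Fin (2 * k + 1)) : ℕ) = 1 := by
    rw [Fin.val_one', Nat.mod_eq_of_lt (by omega)]
  have h01 : (0 : Fin (2 * k + 1)) ≠ 1 := fun h => by
    have := congrArg Fin.val h
    rw [h1v] at this
    simp at this
  have hpair : p (Pi.mulSingle 0 u) = 1 ∧ p (Pi.mulSingle 1 u) = 1 := by
    apply WithOne.eq_one_of_mul_eq_one
    rw [← hmul]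
    -- One minor evaluates `p` with `u` at coordinates `0` and `1`, the other at the all-`1` tuple.
    have := congrFun halt (Pi.mulSingle 0 u)
    simp only [minor] at this
    convert this using 1
    · congr 1
      ext1 j
      by_cases h : j.val ≤ 1
      · have hj : j = 0 ∨ j = 1 := by
          rcases Nat.le_one_iff_eq_zero_or_eq_one.1 h with h | h
          · exact Or.inl (Fin.ext h)
          · exact Or.inr (Fin.ext (h.trans h1v.symm))
        rw [if_pos h, Pi.mul_apply]
        rcases hj with rfl | rfl <;> simp [h01, h01.symm]
      · have hj0 : j ≠ 0 := by rintro rfl; simp at h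
        have hj1 : j ≠ 1 := by rintro rfl; exact h h1v.le
        simp [h, hj0, hj1]
    · rw [← hconst 1]
      congr 1
      ext1 j
      by_cases h : j.val ≤ 1
      · simp [h, h01.symm]
      · have hj0 : j ≠ 0 := by rintro rfl; simp at h
        simp [h, hj0]
  -- Swapping two coordinates of equal parity preserves parity, so `p` is invariant under it.
  have hsingle (i j : Fin (2 * k + 1)) (hij : i.val % 2 = j.val % 2)
      (hj : p (Pi.mulSingle j u) = 1) : p (Pi.mulSingle i u) = 1 := by
    rw [← hj, ← congrFun (hsymm (Equiv.swap i j) fun l => by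
      by_cases hi : l = i
      · simp [hi, hij]
      by_cases hj : l = j
      · simp [hj, hij]
      rw [Equiv.swap_apply_of_ne_of_ne hi hj]) (Pi.mulSingle j u)]
    unfold minor
    congr 1
    ext1 l
    simp only [Pi.mulSingle_apply, Equiv.swap_apply_eq_iff, Equiv.swap_apply_right]
  have hall (i : Fin (2 * k + 1)) : P (Pi.mulSingle i u) = 1 := by
    rcases Nat.mod_two_eq_zero_or_one i.val with h | h
    · exact hsingle i 0 (by simpa using h) hpair.1
    · exact hsingle i 1 (by rw [h, h1v]) hpair.2
  have : P (fun _ => u) = 1 := by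
    rw [← Finset.univ_prod_mulSingle (fun _ : Fin (2 * k + 1) => u), map_prod]
    exact Finset.prod_eq_one fun i _ => hall i
  exact WithOne.coe_ne_one ((hconst u).symm.trans this)

end Lin

end PromiseEq

theorem mainTheorem8 (G : Type*) [CommGroup G] [Finite G] :
    PromiseEq.SolvedByBLPAIP (PromiseEq.linLang (⊤ : Subsemigroup (WithOne G)))
        (WithOne G) (WithOne G) ∧
      ¬ PromiseEq.SolvedByAIP (PromiseEq.linLang (⊤ : Subsemigroup (WithOne G)))
        (WithOne G) (WithOne G) ∧
      ∀ (k : ℕ), 1 ≤ k → ∀ p : (Fin (2 * k + 1) → WithOne G) → WithOne G,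
        PromiseEq.IsPolymorphism (PromiseEq.linLang (⊤ : Subsemigroup (WithOne G))) p →
          ¬ PromiseEq.IsAlternating p :=
  ⟨fun _ _ _ => ⟨fun ⟨h⟩ => PromiseEq.blpAIPAccepts_of_hom h,
      mt PromiseEq.nonempty_hom_of_blpAIPAccepts⟩,
    PromiseEq.not_solvedByAIP,
    fun _ hk _ hp => PromiseEq.not_isAlternating_of_isPolymorphism hk hp⟩
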